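/- Let $\Delta\subset\mathbb{R}^2$ be a finite simplicial complex, and call a face of $\Delta$ a boundary face if it is contained in the topological boundary of $|\Delta|$, and an interior face otherwise. Write $\Delta_0$ for the vertices and $\Delta_0^\circ,\Delta_1^\circ$ for the interior vertices and the interior edges of $\Delta$. Let $\mathtt{R}=\mathbb{R}[x,y]$ and $\mathtt{S}=\mathbb{R}[x,y,z]$, and let $\boldsymbol r=\{r_\tau:\tau\in\Delta_1^\circ\}$ and $\boldsymbol s=\{s_\gamma:\gamma\in\Delta_0\}$ be arbitrary families of non-negative integers. For $\gamma\in\Delta_0$ let $\hat{\mathfrak m}_\gamma\subseteq \mathtt{S}$ be the homogenization (with respect to $z$) of the ideal of all polynomials in $\mathtt{R}$ vanishing at $\gamma$. For an edge $\tau=[\gamma,\gamma']\in\Delta_1^\circ$ let $\ell_\tau\in \mathtt{S}$ be a nonzero linear form vanishing on the cone over $\tau\times\{1\}$ with apex the origin of $\mathbb{R}^3$, and put $$\mathtt{J}(\tau)=\langle \ell_\tau^{\,r_\tau+1}\rangle\cap\hat{\mathfrak m}_\gamma^{\,s_\gamma+1}\cap\hat{\mathfrak m}_{\gamma'}^{\,s_{\gamma'}+1};$$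 for $\gamma\in\Delta_0^\circ$ put $\mathtt{J}(\gamma)=\sum_{\tau\in\Delta_1^\circ,\ \tau\ni\gamma}\mathtt{J}(\tau)$. Let $\mathcal J$ be the complex of graded $\mathtt{S}$-modules $$0\to\bigoplus_{\tau\in\Delta_1^\circ}\mathtt{J}(\tau)[\tau]\xrightarrow{\ \partial_1\ }\bigoplus_{\gamma\in\Delta_0^\circ}\mathtt{J}(\gamma)[\gamma]\to 0,$$ where $\partial_1$ is the restriction of the simplicial boundary map of $\Delta$ relative to its boundary: for a chosen orientation of the edges, $\partial_1[\tau]=[\gamma']-[\gamma]$ if $\tau$ is oriented from $\gamma$ to $\gamma'$, with $[\nu]=0$ for every boundary vertex $\nu$. Then the homology module $H_0(\mathcal J)=\operatorname{coker}\partial_1$ is an $\mathtt{S}$-module of finite length, and $H_0(\mathcal J)_d=0$ for all $d\gg 0$. -/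

import Mathlib

noncomputable section

namespace Superspline

open MvPolynomial

/-- The plane `ℝ²` (only its real vector space structure and its topology are used). -/
abbrev Plane : Type := Fin 2 → ℝ

/-- `R = ℝ[x, y]`, with `x = X 0`, `y = X 1`. -/
abbrev R : Type := MvPolynomial (Fin 2) ℝ

/-- `S = ℝ[x, y, z]`, with `x = X 0`, `y = X 1`, `z = X 2`. -/
abbrev S : Type := MvPolynomial (Fin 3) ℝ

/-- A planar simplicial complex `Δ ⊆ ℝ²`; faces are given by their (finite, nonempty) vertex sets. -/
abbrev PlanarComplex : Type := Geometry.SimplicialComplex ℝ Plane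

/-- A face of `Δ` is a boundary face if it lies in the topological boundary of `|Δ|`, and an
interior face otherwise. -/
def IsInteriorFace (K : PlanarComplex) (β : Finset Plane) : Prop :=
  β ∈ K.faces ∧ ¬ convexHull ℝ (β : Set Plane) ⊆ frontier K.space

/-- The interior vertices `Δ₀°`. -/
abbrev InteriorVertex (K : PlanarComplex) : Type :=
  {v : Plane // IsInteriorFace K {v}}

/-- The interior edges `Δ₁°`. -/
abbrev InteriorEdge (K : PlanarComplex) : Type :=
  {τ : Finset Plane // τ.card = 2 ∧ IsInteriorFace K τ}

/-- The embedding of `ℝ²` as the affine plane `z = 1` in `ℝ³`. -/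
def lift (v : Plane) : Fin 3 → ℝ := ![v 0, v 1, 1]

/-- The cone over a face: the convex hull of the origin of `ℝ³` and the lifted face. -/
def coneOver (β : Finset Plane) : Set (Fin 3 → ℝ) :=
  convexHull ℝ (insert 0 (lift '' convexHull ℝ (β : Set Plane)))

/-- `ℓ` is a (nonzero) linear form in `S` vanishing on the cone over `β`. -/
def IsLinearFormVanishingOn (β : Finset Plane) (ℓ : S) : Prop :=
  ℓ.IsHomogeneous 1 ∧ ℓ ≠ 0 ∧ ∀ p ∈ coneOver β, eval p ℓ = 0

/-- The homogenization of a polynomial of `R` in `S`, with respect to `z`. -/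
def homogenization (f : R) : S :=
  ∑ m ∈ f.support,
    C (f.coeff m) * X 0 ^ m 0 * X 1 ^ m 1 * X 2 ^ (f.totalDegree - (m 0 + m 1))

/-- The maximal ideal `𝔪_v ⊆ R` of all polynomials vanishing at the point `v`. -/
def pointIdeal (v : Plane) : Ideal R := RingHom.ker (eval v)

/-- The homogenization of `𝔪_v`: the ideal of `S` generated by the homogenizations of the elements
of `𝔪_v`. -/
def pointIdealHat (v : Plane) : Ideal S :=
  Ideal.span (homogenization '' (pointIdeal v : Set R))

/-- The ideal `J(τ)` of an interior edge: the intersection of `⟨ℓ_τ ^ (r_τ + 1)⟩` and of the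
ideals `𝔪̂_β ^ (s_β + 1)` for the vertices `β` of `τ`. -/
def edgeIdeal (K : PlanarComplex) (r : InteriorEdge K → ℕ) (s : K.vertices → ℕ)
    (ℓ : InteriorEdge K → S) (τ : InteriorEdge K) : Ideal S :=
  Ideal.span {ℓ τ ^ (r τ + 1)} ⊓
    ⨅ (β : K.vertices) (_ : (β : Plane) ∈ τ.1), pointIdealHat β ^ (s β + 1)

/-- The ideal `J(γ)` of a vertex: the sum of the `J(τ)` for the interior edges `τ` containing it. -/
def vertexIdeal (K : PlanarComplex) (r : InteriorEdge K → ℕ) (s : K.vertices → ℕ)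
    (ℓ : InteriorEdge K → S) (γ : InteriorVertex K) : Ideal S :=
  ⨆ (τ : InteriorEdge K) (_ : γ.1 ∈ τ.1), edgeIdeal K r s ℓ τ

/-- A choice of an orientation of every interior edge. -/
structure EdgeOrientation (K : PlanarComplex) where
  /-- the initial vertex -/
  tail : InteriorEdge K → Plane
  /-- the final vertex -/
  head : InteriorEdge K → Plane
  /-- the edge is the segment between them -/
  eq_pair : ∀ τ, (τ.1 : Set Plane) = {tail τ, head τ}

/-! The following algebra is stated over an arbitrary commutative ring `A`; below, `A = S`. -/

section Algebra

variable {A : Type} [CommRing A]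

/-- The submodule `⨁ᵢ I i` of `⨁ᵢ A[i]`, for a family of ideals `I i`. -/
def idealSum {ι : Type} (I : ι → Ideal A) : Submodule A (ι →₀ A) where
  carrier := {c | ∀ i, c i ∈ I i}
  zero_mem' := fun i => (I i).zero_mem
  add_mem' := fun ha hb i => (I i).add_mem (ha i) (hb i)
  smul_mem' := fun a _ hc i => (I i).mul_mem_left a (hc i)

/-- If a linear map `f : M → N` maps the submodule `P` into the submodule `Q`, the zeroth homology
of the complex `0 → P → Q → 0` with differential `f`: every element of `Q` is a cycle, so this is
`Q` modulo the image of `P`. -/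
def zerothHomology {M N : Type} [AddCommGroup M] [Module A M] [AddCommGroup N] [Module A N]
    (f : M →ₗ[A] N) (P : Submodule A M) (Q : Submodule A N) (h : ∀ x ∈ P, f x ∈ Q) : Type :=
  Q ⧸ LinearMap.range (f.restrict h)

section

variable {M N : Type} [AddCommGroup M] [Module A M] [AddCommGroup N] [Module A N]
    (f : M →ₗ[A] N) (P : Submodule A M) (Q : Submodule A N) (h : ∀ x ∈ P, f x ∈ Q)

instance : AddCommGroup (zerothHomology f P Q h) :=
  inferInstanceAs (AddCommGroup (Q ⧸ LinearMap.range (f.restrict h)))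

instance : Module A (zerothHomology f P Q h) :=
  inferInstanceAs (Module A (Q ⧸ LinearMap.range (f.restrict h)))

/-- The homology class of an element of `Q`. -/
def homologyClass : Q →ₗ[A] zerothHomology f P Q h :=
  (LinearMap.range (f.restrict h)).mkQ

end

/-- The classes, in the zeroth homology of a complex `0 → P → ⨁ᵢ I i → 0`, of the elements of
`⨁ᵢ I i` all of whose components belong to an additive subgroup `D` of `A`. -/
def homologyPart {ι M : Type} [AddCommGroup M] [Module A M] (f : M →ₗ[A] (ι →₀ A))
    (P : Submodule A M) (I : ι → Ideal A) (h : ∀ x ∈ P, f x ∈ idealSum I) (D : AddSubgroup A) :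
    AddSubgroup (zerothHomology f P (idealSum I) h) where
  carrier := {x | ∃ c : idealSum I, (∀ i, c.1 i ∈ D) ∧ homologyClass f P (idealSum I) h c = x}
  zero_mem' := ⟨0, fun _ => D.zero_mem, map_zero _⟩
  add_mem' := by
    rintro _ _ ⟨a, ha, rfl⟩ ⟨b, hb, rfl⟩
    exact ⟨a + b, fun i => D.add_mem (ha i) (hb i), map_add _ _ _⟩
  neg_mem' := by
    rintro _ ⟨a, ha, rfl⟩
    exact ⟨-a, fun i => D.neg_mem (ha i), (homologyClass f P _ h).map_neg a⟩

end Algebra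

open Classical in
/-- The basis symbol `[v]` of `⨁_{γ ∈ Δ₀°} A[γ]`; it is zero if `v` is not an interior vertex. -/
def symbol (A : Type) [CommRing A] (K : PlanarComplex) (v : Plane) : InteriorVertex K →₀ A :=
  if h : IsInteriorFace K {v} then Finsupp.single ⟨v, h⟩ 1 else 0

/-- The boundary map `∂₁ : ⨁_{τ ∈ Δ₁°} A[τ] → ⨁_{γ ∈ Δ₀°} A[γ]` of the simplicial chain complex of
`Δ` relative to its boundary: `[τ] ↦ [head τ] - [tail τ]`. -/
def boundary (A : Type) [CommRing A] (K : PlanarComplex) (o : EdgeOrientation K) :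
    (InteriorEdge K →₀ A) →ₗ[A] (InteriorVertex K →₀ A) :=
  Finsupp.linearCombination A fun τ => symbol A K (o.head τ) - symbol A K (o.tail τ)

theorem boundary_mem {A : Type} [CommRing A] (K : PlanarComplex) (o : EdgeOrientation K)
    (I : InteriorEdge K → Ideal A) (J : InteriorVertex K → Ideal A)
    (hIJ : ∀ τ γ, γ.1 ∈ τ.1 → I τ ≤ J γ) (c : InteriorEdge K →₀ A) (hc : c ∈ idealSum I) :
    boundary A K o c ∈ idealSum J := by
  classical
  have key : ∀ (τ : InteriorEdge K) (v : Plane), v ∈ τ.1 → ∀ f ∈ I τ,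
      f • symbol A K v ∈ idealSum J := by
    intro τ v hv f hf γ
    unfold symbol
    split_ifs with h
    · by_cases hγ : (⟨v, h⟩ : InteriorVertex K) = γ
      · subst hγ
        rw [Finsupp.smul_apply, Finsupp.single_eq_same, smul_eq_mul, mul_one]
        exact hIJ τ ⟨v, h⟩ hv hf
      · rw [Finsupp.smul_apply, Finsupp.single_eq_of_ne' hγ, smul_zero]
        exact (J γ).zero_mem
    · simp
  unfold boundary
  rw [Finsupp.linearCombination_apply]
  refine Submodule.sum_mem _ fun τ _ => ?_
  have ht : o.tail τ ∈ (τ.1 : Set Plane) := by rw [o.eq_pair]; simp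
  have hh : o.head τ ∈ (τ.1 : Set Plane) := by rw [o.eq_pair]; simp
  simp only [smul_sub]
  exact Submodule.sub_mem _ (key τ _ (by simpa using hh) _ (hc τ))
    (key τ _ (by simpa using ht) _ (hc τ))

theorem edgeIdeal_le_vertexIdeal (K : PlanarComplex) (r : InteriorEdge K → ℕ)
    (s : K.vertices → ℕ) (ℓ : InteriorEdge K → S) (τ : InteriorEdge K) (γ : InteriorVertex K)
    (h : γ.1 ∈ τ.1) : edgeIdeal K r s ℓ τ ≤ vertexIdeal K r s ℓ γ :=
  le_iSup₂_of_le (f := fun (τ : InteriorEdge K) (_ : γ.1 ∈ τ.1) => edgeIdeal K r s ℓ τ) τ h le_rfl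

/-- `H₀(𝒥)` for the complex `𝒥 : 0 → ⨁_{τ ∈ Δ₁°} J(τ) → ⨁_{γ ∈ Δ₀°} J(γ) → 0`, whose differential
is the restriction of `∂₁`. -/
abbrev H0 (K : PlanarComplex) (r : InteriorEdge K → ℕ) (s : K.vertices → ℕ)
    (ℓ : InteriorEdge K → S) (o : EdgeOrientation K) : Type :=
  zerothHomology (boundary S K o) (idealSum (edgeIdeal K r s ℓ)) (idealSum (vertexIdeal K r s ℓ))
    (boundary_mem K o _ _ (edgeIdeal_le_vertexIdeal K r s ℓ))

/-- The graded piece `H₀(𝒥)_d`: the classes of the elements of `⨁_{γ ∈ Δ₀°} J(γ)` all of whose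
components are homogeneous of degree `d`. -/
def H0Degree (K : PlanarComplex) (r : InteriorEdge K → ℕ) (s : K.vertices → ℕ)
    (ℓ : InteriorEdge K → S) (o : EdgeOrientation K) (d : ℕ) : AddSubgroup (H0 K r s ℓ o) :=
  homologyPart _ _ _ _ (homogeneousSubmodule (Fin 3) ℝ d).toAddSubgroup

end Superspline

end

/-! It suffices that the annihilator of $H_0(\mathcal J)$ lies in no prime $P$ that fails to contain
$\mathfrak m=(x,y,z)$: its radical then contains $\mathfrak m$. Such a $P$ contains the ideal of at
most one point of the plane (`eq_of_containsPoint`). If $\ell_\tau\notin P$, then $J(\tau)$ is the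
unit ideal locally at $P$, so the symbols of the two ends of $\tau$ agree modulo boundaries. If
$\ell_\tau\in P$, the other two sides of a triangle on $\tau$ serve instead, unless an end of $\tau$
is the special point (`LocallyTrivial.of_adjacent`). Climbing a linear functional away from that
point reaches a non-interior vertex, whose symbol is zero, so every other vertex has a locally
trivial symbol (`locallyTrivial_of_forall_lt`). At the special vertex only the multiples $f[v]$ with
$f\in J(\tau)$ matter, and each is homologous to $f$ times the symbol at the other end of $\tau$
(`exists_mul_smul_symbol_mem`). A power of $\mathfrak m$ therefore kills $H_0(\mathcal J)$, which
gives finite length; Artin–Rees gives the vanishing in high degree. -/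

noncomputable section

namespace Superspline

open MvPolynomial

/-! ### Geometry of the complex near an interior vertex -/

section Geometry

variable {K : PlanarComplex}

/-- From an interior point of `|K|`, the beginning of a segment in any direction lies in a face. -/
theorem exists_face_along_ray (hK : K.faces.Finite) {x : Plane} (hx : x ∈ interior K.space)
    (v : Plane) : ∃ F ∈ K.faces, x ∈ convexHull ℝ (F : Set Plane) ∧
      ∃ t : ℝ, 0 < t ∧ x + t • v ∈ convexHull ℝ (F : Set Plane) := by
  have hcont : Filter.Tendsto (fun t : ℝ => x + t • v) (nhdsWithin 0 (Set.Ioi 0)) (nhds x) := by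
    have h : Continuous fun t : ℝ => x + t • v := by fun_prop
    have h0 := h.tendsto 0
    simp only [zero_smul, add_zero] at h0
    exact h0.mono_left nhdsWithin_le_nhds
  have hspace : ∀ᶠ t : ℝ in nhdsWithin 0 (Set.Ioi 0), x + t • v ∈ K.space :=
    hcont (mem_interior_iff_mem_nhds.1 hx)
  -- Faces are closed and finite in number, so close to `x` only faces through `x` occur.
  have hfar : ∀ᶠ t : ℝ in nhdsWithin 0 (Set.Ioi 0), ∀ F ∈ K.faces,
      x ∉ convexHull ℝ (F : Set Plane) → x + t • v ∉ convexHull ℝ (F : Set Plane) := by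
    rw [Filter.eventually_all_finite hK]
    intro F _
    by_cases hF : x ∈ convexHull ℝ (F : Set Plane)
    · simp [hF]
    · have hclosed : IsClosed (convexHull ℝ (F : Set Plane)) :=
        (F.finite_toSet.isCompact_convexHull ℝ).isClosed
      filter_upwards [hcont (hclosed.isOpen_compl.mem_nhds hF)] with t ht _ using ht
  obtain ⟨t, ⟨ht1, ht2⟩, ht0⟩ := ((hspace.and hfar).and self_mem_nhdsWithin).exists
  obtain ⟨F, hF, hxF⟩ := Geometry.SimplicialComplex.mem_space_iff.1 ht1
  exact ⟨F, hF, by_contra fun h => ht2 F hF h hxF, t, ht0, hxF⟩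

theorem exists_vertex_ge (φ : Plane →ₗ[ℝ] ℝ) {F : Finset Plane} {x : Plane}
    (hx : x ∈ convexHull ℝ (F : Set Plane)) : ∃ w ∈ F, φ x ≤ φ w := by
  by_contra! h
  have : convexHull ℝ (F : Set Plane) ⊆ {y | φ y < φ x} :=
    convexHull_min (fun w hw => h w hw) (convex_halfSpace_lt φ.isLinear _)
  exact lt_irrefl (φ x) (this hx)

theorem singleton_mem_faces {F : Finset Plane} (hF : F ∈ K.faces) {v : Plane} (hv : v ∈ F) :
    {v} ∈ K.faces :=
  K.down_closed hF (by simpa using hv) (by simp)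

theorem mem_interior_of_isInteriorFace {v : Plane} (hv : IsInteriorFace K {v}) :
    v ∈ interior K.space := by
  have hs : v ∈ K.space := K.subset_space hv.1 (by simp)
  have hf : v ∉ frontier K.space := by simpa using hv.2
  rw [← self_sdiff_frontier]
  exact ⟨hs, hf⟩

theorem mem_of_mem_convexHull {F : Finset Plane} (hF : F ∈ K.faces) {v : Plane}
    (hv : {v} ∈ K.faces) (h : v ∈ convexHull ℝ (F : Set Plane)) : v ∈ F := by
  have h1 : v ∈ convexHull ℝ ((({v} : Finset Plane) : Set Plane) ∩ F) :=
    K.inter_subset_convexHull hv hF ⟨by simp, h⟩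
  by_contra hvF
  have : (({v} : Finset Plane) : Set Plane) ∩ F = ∅ := by
    ext y
    simp only [Finset.coe_singleton, Set.mem_inter_iff, Set.mem_singleton_iff,
      Set.mem_empty_iff_false, iff_false, not_and]
    rintro rfl
    exact hvF
  rw [this, convexHull_empty] at h1
  exact h1

/-- The edges at an interior vertex do not lie in a closed half plane. -/
theorem exists_adjacent_gt (hK : K.faces.Finite) {v : Plane} (hv : IsInteriorFace K {v})
    {φ : Plane →ₗ[ℝ] ℝ} (hφ : φ ≠ 0) : ∃ F ∈ K.faces, v ∈ F ∧ ∃ w ∈ F, φ v < φ w := by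
  obtain ⟨u, hu⟩ : ∃ u, 0 < φ u := by
    obtain ⟨u, hu⟩ : ∃ u, φ u ≠ 0 := by
      by_contra! h
      exact hφ (LinearMap.ext h)
    rcases hu.lt_or_gt with h | h
    · exact ⟨-u, by simpa using h⟩
    · exact ⟨u, h⟩
  obtain ⟨F, hF, hvF, t, ht, htF⟩ :=
    exists_face_along_ray hK (mem_interior_of_isInteriorFace hv) u
  obtain ⟨w, hw, hle⟩ := exists_vertex_ge φ htF
  refine ⟨F, hF, mem_of_mem_convexHull hF hv.1 hvF, w, hw, lt_of_lt_of_le ?_ hle⟩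
  simp only [map_add, map_smul, smul_eq_mul]
  have := mul_pos ht hu
  linarith

/-- Two faces meet in the hull of their common vertices; were an end of the edge missing from `F`,
that hull would be at most the other end, which is not strictly between the two. -/
theorem mem_of_lineMap_mem_convexHull {F E : Finset Plane} (hF : F ∈ K.faces) (hE : E ∈ K.faces)
    {a b : Plane} (hab : a ≠ b) (hEab : ∀ x ∈ E, x = a ∨ x = b) (ha : a ∈ E) (hb : b ∈ E)
    {t : ℝ} (ht0 : 0 < t) (ht1 : t < 1)
    (hF' : a + t • (b - a) ∈ convexHull ℝ (F : Set Plane)) : a ∈ F ∧ b ∈ F := by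
  have hmem : a + t • (b - a) ∈ convexHull ℝ ((E : Set Plane) ∩ F) := by
    refine K.inter_subset_convexHull hE hF ⟨?_, hF'⟩
    exact (convex_convexHull ℝ _).add_smul_sub_mem (subset_convexHull ℝ _ ha)
      (subset_convexHull ℝ _ hb) ⟨ht0.le, ht1.le⟩
  have hne : b - a ≠ 0 := sub_ne_zero.2 hab.symm
  constructor
  · by_contra haF
    have hsub : (E : Set Plane) ∩ F ⊆ {b} := by
      rintro x ⟨hxE, hxF⟩
      rcases hEab x hxE with rfl | rfl
      · exact absurd hxF haF
      · rfl
    have h := convexHull_mono hsub hmem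
    rw [convexHull_singleton, Set.mem_singleton_iff] at h
    have h2 : (1 - t) • (b - a) = 0 := by
      rw [sub_smul, one_smul, sub_eq_zero, sub_eq_iff_eq_add', h]
    rcases smul_eq_zero.1 h2 with h3 | h3
    · linarith
    · exact hne h3
  · by_contra hbF
    have hsub : (E : Set Plane) ∩ F ⊆ {a} := by
      rintro x ⟨hxE, hxF⟩
      rcases hEab x hxE with rfl | rfl
      · rfl
      · exact absurd hxF hbF
    have h := convexHull_mono hsub hmem
    rw [convexHull_singleton, Set.mem_singleton_iff, add_eq_left] at h
    rcases smul_eq_zero.1 h with h3 | h3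
    · linarith
    · exact hne h3

/-- The signed area spanned by three points of the plane. -/
def area (a b w : Plane) : ℝ := (b 0 - a 0) * (w 1 - a 1) - (b 1 - a 1) * (w 0 - a 0)

/-- Every edge at an interior vertex lies in a triangle. -/
theorem exists_triangle (hK : K.faces.Finite) {a b : Plane} (ha : IsInteriorFace K {a})
    (hab : a ≠ b) {F : Finset Plane} (hF : F ∈ K.faces) (haF : a ∈ F) (hbF : b ∈ F) :
    ∃ T ∈ K.faces, a ∈ T ∧ b ∈ T ∧ ∃ w ∈ T, area a b w ≠ 0 := by
  classical
  have hE : ({a, b} : Finset Plane) ∈ K.faces :=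
    K.down_closed hF (by simp [Finset.insert_subset_iff, haF, hbF]) (by simp)
  obtain ⟨t, hmem, ht0, ht1⟩ : ∃ t : ℝ, a + t • (b - a) ∈ interior K.space ∧ 0 < t ∧ t < 1 := by
    have hc : Continuous fun t : ℝ => a + t • (b - a) := by fun_prop
    have h0 := hc.tendsto 0
    simp only [zero_smul, add_zero] at h0
    have h1 : ∀ᶠ t : ℝ in nhdsWithin 0 (Set.Ioi 0), a + t • (b - a) ∈ interior K.space :=
      (h0.mono_left nhdsWithin_le_nhds)
        (isOpen_interior.mem_nhds (mem_interior_of_isInteriorFace ha))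
    have h2 : ∀ᶠ t : ℝ in nhdsWithin 0 (Set.Ioi 0), 0 < t ∧ t < 1 := Ioo_mem_nhdsGT one_pos
    exact (h1.and h2).exists
  -- Leave the edge along its normal. The functional `φ` below satisfies `φ w - φ a = area a b w`
  -- and increases in this direction, so some vertex of `T` lies strictly off the line.
  obtain ⟨T, hT, hmT, c, hc, hcT⟩ :=
    exists_face_along_ray hK hmem ![-(b 1 - a 1), b 0 - a 0]
  obtain ⟨haT, hbT⟩ := mem_of_lineMap_mem_convexHull hT hE hab (by simp) (by simp) (by simp)
    ht0 ht1 hmT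
  refine ⟨T, hT, haT, hbT, ?_⟩
  let φ : Plane →ₗ[ℝ] ℝ :=
    (b 0 - a 0) • LinearMap.proj 1 - (b 1 - a 1) • LinearMap.proj 0
  obtain ⟨w, hw, hle⟩ := exists_vertex_ge φ hcT
  refine ⟨w, hw, ne_of_gt ?_⟩
  have hsq : 0 < (b 0 - a 0) ^ 2 + (b 1 - a 1) ^ 2 := by
    by_contra! h
    have h0 : b 0 - a 0 = 0 := by nlinarith [sq_nonneg (b 0 - a 0), sq_nonneg (b 1 - a 1)]
    have h1 : b 1 - a 1 = 0 := by nlinarith [sq_nonneg (b 0 - a 0), sq_nonneg (b 1 - a 1)]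
    apply hab
    ext i
    fin_cases i
    · simpa using (sub_eq_zero.1 h0).symm
    · simpa using (sub_eq_zero.1 h1).symm
  have := mul_pos hc hsq
  simp only [φ, LinearMap.sub_apply, LinearMap.smul_apply, LinearMap.proj_apply, Pi.add_apply,
    Pi.smul_apply, Pi.sub_apply, smul_eq_mul, Matrix.cons_val_zero, Matrix.cons_val_one] at hle
  unfold area
  linarith

theorem isInteriorFace_of_mem {F : Finset Plane} (hF : F ∈ K.faces) {v : Plane}
    (hv : IsInteriorFace K {v}) (hvF : v ∈ F) : IsInteriorFace K F :=
  ⟨hF, fun h => hv.2 (by simpa using h (subset_convexHull ℝ _ hvF))⟩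

/-- Two distinct vertices of a face, one of them interior, are joined by an interior edge. -/
theorem exists_interiorEdge {F : Finset Plane} (hF : F ∈ K.faces) {a b : Plane}
    (ha : IsInteriorFace K {a}) (haF : a ∈ F) (hbF : b ∈ F) (hab : a ≠ b) :
    ∃ τ : InteriorEdge K, a ∈ τ.1 ∧ b ∈ τ.1 := by
  classical
  have hE : ({a, b} : Finset Plane) ∈ K.faces :=
    K.down_closed hF (by simp [Finset.insert_subset_iff, haF, hbF]) (by simp)
  exact ⟨⟨{a, b}, Finset.card_pair hab, isInteriorFace_of_mem hE ha (by simp)⟩, by simp, by simp⟩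

end Geometry

/-! ### Linear forms of edges and ideals of points -/

section LinearForms

/-- For `j = 0, 1`, the forms `X j - v j * z`, which generate the ideal of the point `v`. -/
def pointForm (v : Plane) (j : Fin 2) : S := X j.castSucc - C (v j) * X 2

theorem homogenization_eq_sum {f : R} {T : Finset (Fin 2 →₀ ℕ)} (h : f.support ⊆ T) :
    homogenization f = ∑ m ∈ T,
      C (f.coeff m) * X 0 ^ m 0 * X 1 ^ m 1 * X 2 ^ (f.totalDegree - (m 0 + m 1)) := by
  unfold homogenization
  refine Finset.sum_subset h fun m _ hm => ?_
  rw [notMem_support_iff.1 hm]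
  simp

theorem homogenization_X_sub_C (j : Fin 2) (c : ℝ) :
    homogenization (X j - C c : R) = X j.castSucc - C c * X 2 := by
  classical
  have hdeg : (X j - C c : R).totalDegree = 1 := by
    rw [sub_eq_add_neg, ← C_neg, totalDegree_add_eq_left_of_totalDegree_lt] <;> simp
  have hne : (Finsupp.single j 1 : Fin 2 →₀ ℕ) ≠ 0 := by simp
  have hsupp : (X j - C c : R).support ⊆ {Finsupp.single j 1, 0} := by
    intro m hm
    by_contra h
    simp only [Finset.mem_insert, Finset.mem_singleton, not_or] at h
    rw [mem_support_iff] at hm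
    apply hm
    rw [coeff_sub, coeff_X, coeff_C, if_neg (Ne.symm h.1), if_neg (Ne.symm h.2), sub_zero]
  have h1 : (X j - C c : R).coeff (Finsupp.single j 1) = 1 := by
    rw [coeff_sub, coeff_X, coeff_C, if_pos rfl, if_neg hne.symm, sub_zero]
  have h0 : (X j - C c : R).coeff 0 = -c := by
    rw [coeff_sub, coeff_X, coeff_C, if_neg hne, if_pos rfl, zero_sub]
  rw [homogenization_eq_sum hsupp, Finset.sum_pair hne, hdeg, h1, h0]
  fin_cases j <;> simp <;> ring

theorem pointForm_mem_pointIdealHat (v : Plane) (j : Fin 2) :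
    pointForm v j ∈ pointIdealHat v := by
  refine Ideal.subset_span ⟨X j - C (v j), ?_, homogenization_X_sub_C j (v j)⟩
  simp [pointIdeal, RingHom.mem_ker]

theorem exists_coefficients {f : S} (hf : f.IsHomogeneous 1) :
    ∃ a b c : ℝ, f = C a * X 0 + C b * X 1 + C c * X 2 := by
  have h : f ∈ homogeneousSubmodule (Fin 3) ℝ 1 := hf
  rw [homogeneousSubmodule_one_eq_span_X, Submodule.mem_span_range_iff_exists_fun] at h
  obtain ⟨c, rfl⟩ := h
  exact ⟨c 0, c 1, c 2, by simp [Fin.sum_univ_three, smul_eq_C_mul]⟩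

theorem lift_mem_coneOver {β : Finset Plane} {v : Plane} (hv : v ∈ β) : lift v ∈ coneOver β :=
  subset_convexHull ℝ _ (Set.mem_insert_of_mem _ ⟨v, subset_convexHull ℝ _ hv, rfl⟩)

/-- The linear form of an edge, in terms of the forms of one of its vertices. -/
theorem exists_eq_pointForm {β : Finset Plane} {f : S} (hf : IsLinearFormVanishingOn β f)
    {v : Plane} (hv : v ∈ β) : ∃ a b : ℝ, f = C a * pointForm v 0 + C b * pointForm v 1 ∧
      (a ≠ 0 ∨ b ≠ 0) ∧ ∀ w ∈ β, a * (w 0 - v 0) + b * (w 1 - v 1) = 0 := by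
  obtain ⟨hhom, hne, hvan⟩ := hf
  obtain ⟨a, b, c, rfl⟩ := exists_coefficients hhom
  have key : ∀ w ∈ β, a * w 0 + b * w 1 + c = 0 := by
    intro w hw
    simpa [lift] using hvan _ (lift_mem_coneOver hw)
  have hc : c = -(a * v 0 + b * v 1) := by linarith [key v hv]
  have heq : (C a * X 0 + C b * X 1 + C c * X 2 : S) =
      C a * pointForm v 0 + C b * pointForm v 1 := by
    subst hc
    simp only [pointForm, map_neg, map_add, map_mul, Fin.castSucc_zero, Fin.castSucc_one]
    ring
  refine ⟨a, b, heq, ?_, fun w hw => by linarith [key w hw, key v hv]⟩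
  by_contra! h
  apply hne
  rw [heq, h.1, h.2]
  simp

theorem linearForm_mem_pointIdealHat {β : Finset Plane} {f : S}
    (hf : IsLinearFormVanishingOn β f) {v : Plane} (hv : v ∈ β) : f ∈ pointIdealHat v := by
  obtain ⟨a, b, rfl, -⟩ := exists_eq_pointForm hf hv
  exact Ideal.add_mem _ (Ideal.mul_mem_left _ _ (pointForm_mem_pointIdealHat v 0))
    (Ideal.mul_mem_left _ _ (pointForm_mem_pointIdealHat v 1))

/-- The projective zero set of the ideal `P` contains the point `v`. -/
def ContainsPoint (P : Ideal S) (v : Plane) : Prop := ∀ j, pointForm v j ∈ P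

theorem mem_of_C_mul_mem {P : Ideal S} {c : ℝ} (hc : c ≠ 0) {f : S} (h : C c * f ∈ P) :
    f ∈ P := by
  have := P.mul_mem_left (C c⁻¹) h
  rwa [← mul_assoc, ← C_mul, inv_mul_cancel₀ hc, C_1, one_mul] at this

/-- The forms of two distinct points differ by a nonzero multiple of $z$; once $z\in P$, so are $x$
and $y$. -/
theorem eq_of_containsPoint {P : Ideal S} (hP : ¬ idealOfVars (Fin 3) ℝ ≤ P) {v w : Plane}
    (hv : ContainsPoint P v) (hw : ContainsPoint P w) : v = w := by
  by_contra hne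
  obtain ⟨j, hj⟩ : ∃ j, v j ≠ w j := by
    by_contra! h
    exact hne (funext h)
  have hz : (X 2 : S) ∈ P := by
    refine mem_of_C_mul_mem (sub_ne_zero.2 hj) ?_
    have := P.sub_mem (hw j) (hv j)
    have e : pointForm w j - pointForm v j = C (v j - w j) * X 2 := by
      simp only [pointForm, map_sub]
      ring
    rwa [e] at this
  have hx : ∀ i : Fin 2, (X i.castSucc : S) ∈ P := fun i => by
    have := P.add_mem (hv i) (P.mul_mem_left (C (v i)) hz)
    rwa [pointForm, sub_add_cancel] at this
  apply hP
  rw [Ideal.span_le]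
  rintro _ ⟨i, rfl⟩
  fin_cases i
  · exact hx 0
  · exact hx 1
  · exact hz

/-- If two edges at `v` on different lines have their forms in `P`, then `P` contains the ideal of
the point `v`. -/
theorem containsPoint_of_mem {P : Ideal S} {β β' : Finset Plane} {f f' : S}
    (hf : IsLinearFormVanishingOn β f) (hf' : IsLinearFormVanishingOn β' f') {v b w : Plane}
    (hv : v ∈ β) (hb : b ∈ β) (hv' : v ∈ β') (hw : w ∈ β') (harea : area v b w ≠ 0)
    (hfP : f ∈ P) (hfP' : f' ∈ P) : ContainsPoint P v := by
  obtain ⟨p, q, rfl, hne, hpq⟩ := exists_eq_pointForm hf hv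
  obtain ⟨p', q', rfl, hne', hpq'⟩ := exists_eq_pointForm hf' hv'
  have h1 := hpq b hb
  have h2 := hpq' w hw
  -- If the forms were proportional, the normal `(p, q)` would annihilate both `b - v` and `w - v`,
  -- which are independent by `harea`.
  have hdet : p * q' - p' * q ≠ 0 := by
    intro hdet
    have e : p * (w 0 - v 0) + q * (w 1 - v 1) = 0 := by
      rcases hne' with h | h
      · refine (mul_eq_zero.1 ?_).resolve_left h
        linear_combination p * h2 - (w 1 - v 1) * hdet
      · refine (mul_eq_zero.1 ?_).resolve_left h
        linear_combination q * h2 + (w 0 - v 0) * hdet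
    have hp : p = 0 := by
      refine (mul_eq_zero.1 ?_).resolve_right harea
      unfold area
      linear_combination (w 1 - v 1) * h1 - (b 1 - v 1) * e
    have hq : q = 0 := by
      refine (mul_eq_zero.1 ?_).resolve_right harea
      unfold area
      linear_combination (b 0 - v 0) * e - (w 0 - v 0) * h1
    rcases hne with h | h
    · exact h hp
    · exact h hq
  -- Cramer's rule recovers the two forms of the point `v`.
  intro j
  refine mem_of_C_mul_mem hdet ?_
  fin_cases j
  · have := P.sub_mem (P.mul_mem_left (C q') hfP) (P.mul_mem_left (C q) hfP')
    convert this using 1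
    simp only [map_sub, map_mul, Fin.zero_eta]
    ring
  · have := P.sub_mem (P.mul_mem_left (C p) hfP') (P.mul_mem_left (C p') hfP)
    convert this using 1
    simp only [map_sub, map_mul, Fin.mk_one]
    ring

end LinearForms

/-! ### Vanishing away from the irrelevant ideal -/

section Localization

variable {K : PlanarComplex} {r : InteriorEdge K → ℕ} {s : K.vertices → ℕ}
  {ℓ : InteriorEdge K → S} {o : EdgeOrientation K}

theorem finite_interiorEdge (hK : K.faces.Finite) : Finite (InteriorEdge K) :=
  (hK.subset fun _ h => h.2.1 : {τ : Finset Plane | τ.card = 2 ∧ IsInteriorFace K τ}.Finite)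

theorem finite_vertices (hK : K.faces.Finite) : K.vertices.Finite :=
  (hK.preimage (Finset.singleton_injective.injOn) : {v : Plane | {v} ∈ K.faces}.Finite)

theorem finite_interiorVertex (hK : K.faces.Finite) : Finite (InteriorVertex K) :=
  ((finite_vertices hK).subset fun _ h => h.1 : {v : Plane | IsInteriorFace K {v}}.Finite)

/-- As $\ell_\tau$ lies in the ideals of both ends of $\tau$, a large power lies in every ideal
intersected. The exponent is crude: it sums over all vertices. -/
theorem exists_pow_mem_edgeIdeal (hK : K.faces.Finite)
    (hℓ : ∀ τ, IsLinearFormVanishingOn τ.1 (ℓ τ)) (τ : InteriorEdge K) :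
    ∃ N : ℕ, ℓ τ ^ N ∈ edgeIdeal K r s ℓ τ := by
  have := (finite_vertices hK).fintype
  refine ⟨(r τ + 1) + ∑ β, (s β + 1), ?_, ?_⟩
  · exact Ideal.mem_span_singleton.2 (pow_dvd_pow _ (Nat.le_add_right _ _))
  · simp only [SetLike.mem_coe, Submodule.mem_iInf]
    intro β hβ
    refine Ideal.pow_le_pow_right (I := pointIdealHat β) ?_
      (Ideal.pow_mem_pow (linearForm_mem_pointIdealHat (hℓ τ) hβ) _)
    have := Finset.single_le_sum (f := fun β => s β + 1) (fun _ _ => Nat.zero_le _)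
      (Finset.mem_univ β)
    exact this.trans (Nat.le_add_left _ _)

/-- The module of boundaries of the complex `𝒥`. -/
def boundaries (K : PlanarComplex) (r : InteriorEdge K → ℕ) (s : K.vertices → ℕ)
    (ℓ : InteriorEdge K → S) (o : EdgeOrientation K) : Submodule S (InteriorVertex K →₀ S) :=
  (idealSum (edgeIdeal K r s ℓ)).map (boundary S K o)

theorem smul_symbol_sub_mem_boundaries {τ : InteriorEdge K} {v w : Plane} (hv : v ∈ τ.1)
    (hw : w ∈ τ.1) {f : S} (hf : f ∈ edgeIdeal K r s ℓ τ) :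
    f • (symbol S K v - symbol S K w) ∈ boundaries K r s ℓ o := by
  classical
  have key : f • (symbol S K (o.head τ) - symbol S K (o.tail τ)) ∈ boundaries K r s ℓ o := by
    refine ⟨Finsupp.single τ f, fun σ => ?_, ?_⟩
    · by_cases h : τ = σ
      · subst h
        simpa using hf
      · rw [Finsupp.single_eq_of_ne' h]
        exact zero_mem _
    · simp [boundary, Finsupp.linearCombination_single]
  have hmem : ∀ u ∈ τ.1, u = o.tail τ ∨ u = o.head τ := fun u hu => by
    have : u ∈ (τ.1 : Set Plane) := hu
    rw [o.eq_pair] at this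
    simpa using this
  rcases hmem v hv with rfl | rfl <;> rcases hmem w hw with h | h <;> rw [h]
  · simp
  · rw [← neg_sub, smul_neg]
    exact neg_mem key
  · exact key
  · simp

/-- The symbol of `v` vanishes in the localization of `H₀(𝒥)` at `P`. -/
def LocallyTrivial (K : PlanarComplex) (r : InteriorEdge K → ℕ) (s : K.vertices → ℕ)
    (ℓ : InteriorEdge K → S) (o : EdgeOrientation K) (P : Ideal S) (v : Plane) : Prop :=
  ∃ g ∉ P, g • symbol S K v ∈ boundaries K r s ℓ o

variable {P : Ideal S}

theorem locallyTrivial_of_not_isInteriorFace [P.IsPrime] {v : Plane}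
    (hv : ¬ IsInteriorFace K {v}) : LocallyTrivial K r s ℓ o P v :=
  ⟨1, (Ideal.ne_top_iff_one P).1 Ideal.IsPrime.ne_top', by simp [symbol, hv]⟩

theorem LocallyTrivial.of_edge [P.IsPrime] (hK : K.faces.Finite)
    (hℓ : ∀ τ, IsLinearFormVanishingOn τ.1 (ℓ τ)) {v w : Plane}
    (h : LocallyTrivial K r s ℓ o P w) {τ : InteriorEdge K} (hv : v ∈ τ.1) (hw : w ∈ τ.1)
    (hτ : ℓ τ ∉ P) : LocallyTrivial K r s ℓ o P v := by
  obtain ⟨g, hg, hgw⟩ := h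
  obtain ⟨N, hN⟩ := exists_pow_mem_edgeIdeal (r := r) (s := s) hK hℓ τ
  refine ⟨g * ℓ τ ^ N, fun h => ?_, ?_⟩
  · rcases Ideal.IsPrime.mem_or_mem ‹_› h with h | h
    · exact hg h
    · exact hτ (Ideal.IsPrime.mem_of_pow_mem ‹_› _ h)
  · have h1 := smul_symbol_sub_mem_boundaries (o := o) hv hw (Ideal.mul_mem_left _ g hN)
    have h2 := (boundaries K r s ℓ o).smul_mem (ℓ τ ^ N) hgw
    have h3 := add_mem h1 h2
    rwa [smul_smul, mul_comm (ℓ τ ^ N) g, ← smul_add, sub_add_cancel] at h3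

/-- When the form of `vw` lies in `P`, detour through the third vertex `u` of a triangle: a second
form in `P` at `v` or at `w` would make that vertex the special point. -/
theorem LocallyTrivial.of_adjacent [P.IsPrime] (hK : K.faces.Finite)
    (hℓ : ∀ τ, IsLinearFormVanishingOn τ.1 (ℓ τ)) {v w : Plane} (hv : IsInteriorFace K {v})
    (hvP : ¬ ContainsPoint P v) (hwP : ¬ ContainsPoint P w) {F : Finset Plane} (hF : F ∈ K.faces)
    (hvF : v ∈ F) (hwF : w ∈ F) (h : LocallyTrivial K r s ℓ o P w) :
    LocallyTrivial K r s ℓ o P v := by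
  by_cases hvw : v = w
  · exact hvw ▸ h
  obtain ⟨τ, hvτ, hwτ⟩ := exists_interiorEdge hF hv hvF hwF hvw
  by_cases hτ : ℓ τ ∉ P
  · exact h.of_edge hK hℓ hvτ hwτ hτ
  rw [not_not] at hτ
  obtain ⟨T, hT, hvT, hwT, u, huT, harea⟩ := exists_triangle hK hv hvw hF hvF hwF
  have hvu : v ≠ u := by
    rintro rfl
    simp [area] at harea
  have hwu : w ≠ u := by
    rintro rfl
    apply harea
    unfold area
    ring
  obtain ⟨σ, hvσ, huσ⟩ := exists_interiorEdge hT hv hvT huT hvu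
  have hσ : ℓ σ ∉ P := fun hσ =>
    hvP (containsPoint_of_mem (hℓ τ) (hℓ σ) hvτ hwτ hvσ huσ harea hτ hσ)
  -- If `u` is not interior its symbol is already zero; otherwise continue from `u` to `w`.
  refine LocallyTrivial.of_edge hK hℓ ?_ hvσ huσ hσ
  by_cases hu : IsInteriorFace K {u}
  · obtain ⟨ρ, huρ, hwρ⟩ := exists_interiorEdge hT hu huT hwT hwu.symm
    have harea' : area w v u ≠ 0 := fun h0 => harea (by
      unfold area at h0 ⊢
      linear_combination -h0)
    have hρ : ℓ ρ ∉ P := fun hρ =>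
      hwP (containsPoint_of_mem (hℓ τ) (hℓ ρ) hwτ hvτ hwρ huρ harea' hτ hρ)
    exact h.of_edge hK hℓ huρ hwρ hρ
  · exact locallyTrivial_of_not_isInteriorFace hu

/-- Induction on the finite vertex set, from large `φ` downwards: an interior vertex has a neighbour
with larger `φ`, which is still above every point of `P`. -/
theorem locallyTrivial_of_forall_lt [P.IsPrime] (hK : K.faces.Finite)
    (hℓ : ∀ τ, IsLinearFormVanishingOn τ.1 (ℓ τ)) {φ : Plane →ₗ[ℝ] ℝ} (hφ : φ ≠ 0) (v : Plane)
    (hv : v ∈ K.vertices) (hlt : ∀ b, ContainsPoint P b → φ b < φ v) :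
    LocallyTrivial K r s ℓ o P v := by
  have hwf : K.vertices.WellFoundedOn fun a b => φ b < φ a := by
    have : IsStrictOrder Plane fun a b => φ b < φ a :=
      { irrefl := fun a => lt_irrefl (φ a), trans := fun a b c h1 h2 => h2.trans h1 }
    exact (finite_vertices hK).wellFoundedOn
  revert hlt
  refine hwf.induction (P := fun v => (∀ b, ContainsPoint P b → φ b < φ v) →
    LocallyTrivial K r s ℓ o P v) hv ?_
  intro v _ ih hlt
  by_cases hint : IsInteriorFace K {v}
  · obtain ⟨F, hF, hvF, w, hwF, hvw⟩ := exists_adjacent_gt hK hint hφ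
    refine LocallyTrivial.of_adjacent hK hℓ hint (fun h => lt_irrefl _ (hlt v h))
      (fun h => lt_asymm hvw (hlt w h)) hF hvF hwF ?_
    exact ih w (singleton_mem_faces hF hwF) hvw fun b hb => (hlt b hb).trans hvw
  · exact locallyTrivial_of_not_isInteriorFace hint

theorem exists_linearMap_lt {a b : Plane} (h : a ≠ b) : ∃ φ : Plane →ₗ[ℝ] ℝ, φ a < φ b := by
  obtain ⟨j, hj⟩ : ∃ j, a j ≠ b j := by
    by_contra! h'
    exact h (funext h')
  rcases hj.lt_or_gt with hj | hj
  · exact ⟨LinearMap.proj j, hj⟩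
  · exact ⟨-LinearMap.proj j, by simpa using hj⟩

theorem locallyTrivial_of_not_containsPoint [P.IsPrime] (hK : K.faces.Finite)
    (hℓ : ∀ τ, IsLinearFormVanishingOn τ.1 (ℓ τ)) (hP : ¬ idealOfVars (Fin 3) ℝ ≤ P) {v : Plane}
    (hv : v ∈ K.vertices) (hvP : ¬ ContainsPoint P v) : LocallyTrivial K r s ℓ o P v := by
  by_cases hb : ∃ b, ContainsPoint P b
  · obtain ⟨b, hb⟩ := hb
    obtain ⟨φ, hφ⟩ := exists_linearMap_lt (a := b) (b := v) (fun h => hvP (h ▸ hb))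
    refine locallyTrivial_of_forall_lt hK hℓ (φ := φ) ?_ v hv fun b' hb' => ?_
    · rintro rfl
      simp at hφ
    · rwa [eq_of_containsPoint hP hb' hb]
  · push Not at hb
    obtain ⟨φ, hφ⟩ := exists_linearMap_lt (a := (0 : Plane)) (b := 1) zero_ne_one
    refine locallyTrivial_of_forall_lt hK hℓ (φ := φ) ?_ v hv fun b' hb' => absurd hb' (hb b')
    rintro rfl
    simp at hφ

/-- At most one end of the edge is the special point, so one end has a locally trivial symbol, and
elements of $J(\tau)$ carry this to the other. The multiplier `g` does not depend on `f`. -/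
theorem exists_mul_smul_symbol_mem [P.IsPrime] (hK : K.faces.Finite)
    (hℓ : ∀ τ, IsLinearFormVanishingOn τ.1 (ℓ τ)) (hP : ¬ idealOfVars (Fin 3) ℝ ≤ P)
    {τ : InteriorEdge K} {v : Plane} (hv : v ∈ τ.1) :
    ∃ g ∉ P, ∀ f ∈ edgeIdeal K r s ℓ τ, (g * f) • symbol S K v ∈ boundaries K r s ℓ o := by
  classical
  have hvert : ∀ w ∈ τ.1, w ∈ K.vertices := fun w hw => singleton_mem_faces τ.2.2.1 hw
  obtain ⟨w, hw, hwv⟩ := Finset.exists_mem_ne (by rw [τ.2.1]; norm_num) v (s := τ.1)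
  have hor : LocallyTrivial K r s ℓ o P v ∨ LocallyTrivial K r s ℓ o P w := by
    by_cases hvP : ContainsPoint P v
    · exact Or.inr (locallyTrivial_of_not_containsPoint hK hℓ hP (hvert w hw)
        fun hwP => hwv (eq_of_containsPoint hP hwP hvP))
    · exact Or.inl (locallyTrivial_of_not_containsPoint hK hℓ hP (hvert v hv) hvP)
  rcases hor with ⟨g, hg, h⟩ | ⟨g, hg, h⟩
  · refine ⟨g, hg, fun f _ => ?_⟩
    rw [mul_comm, ← smul_smul]
    exact Submodule.smul_mem _ _ h
  · refine ⟨g, hg, fun f hf => ?_⟩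
    have h1 := smul_symbol_sub_mem_boundaries (o := o) hv hw (Ideal.mul_mem_left _ g hf)
    have h2 := add_mem h1 ((boundaries K r s ℓ o).smul_mem f h)
    rwa [smul_smul, mul_comm f g, ← smul_add, sub_add_cancel] at h2

theorem single_mem_of_forall {M : Submodule S (InteriorVertex K →₀ S)} {g : S}
    (γ : InteriorVertex K)
    (h : ∀ τ : InteriorEdge K, γ.1 ∈ τ.1 → ∀ f ∈ edgeIdeal K r s ℓ τ,
      (g * f) • symbol S K γ.1 ∈ M) {f : S} (hf : f ∈ vertexIdeal K r s ℓ γ) :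
    g • Finsupp.single γ f ∈ M := by
  have hle : vertexIdeal K r s ℓ γ ≤ M.comap (g • Finsupp.lsingle γ) := by
    refine iSup₂_le fun τ hτ f hf => ?_
    have := h τ hτ f hf
    have hsym : symbol S K γ.1 = Finsupp.single γ 1 := by
      unfold symbol
      rw [dif_pos γ.2]
    rw [hsym, Finsupp.smul_single, smul_eq_mul, mul_one] at this
    simpa [Finsupp.smul_single] using this
  simpa using hle hf

/-- `H₀(𝒥)` vanishes at every prime ideal which is not the irrelevant one: the ideal annihilating
it is not contained in such a prime. -/
theorem colon_not_le [P.IsPrime] (hK : K.faces.Finite)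
    (hℓ : ∀ τ, IsLinearFormVanishingOn τ.1 (ℓ τ)) (hP : ¬ idealOfVars (Fin 3) ℝ ≤ P) :
    ¬ (boundaries K r s ℓ o).colon (idealSum (vertexIdeal K r s ℓ)) ≤ P := by
  classical
  have := finite_interiorEdge hK
  have := finite_interiorVertex hK
  have := Fintype.ofFinite (InteriorEdge K)
  have := Fintype.ofFinite (InteriorVertex K)
  have hex : ∀ p : InteriorVertex K × InteriorEdge K, ∃ g ∉ P, p.1.1 ∈ p.2.1 →
      ∀ f ∈ edgeIdeal K r s ℓ p.2, (g * f) • symbol S K p.1.1 ∈ boundaries K r s ℓ o := by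
    intro p
    by_cases hp : p.1.1 ∈ p.2.1
    · obtain ⟨g, hg, h⟩ := exists_mul_smul_symbol_mem (r := r) (s := s) (o := o) hK hℓ hP hp
      exact ⟨g, hg, fun _ => h⟩
    · exact ⟨1, (Ideal.ne_top_iff_one P).1 Ideal.IsPrime.ne_top', fun h => absurd h hp⟩
  choose g hg h using hex
  intro hle
  -- One multiplier for all incident pairs; the others contribute the factor given by `hex`, also
  -- outside the prime `P`.
  have hprod : ∏ p, g p ∉ P := fun hmem => by
    obtain ⟨p, -, hp⟩ := Ideal.IsPrime.prod_mem_iff.1 hmem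
    exact hg p hp
  refine hprod (hle (Submodule.mem_colon.2 fun c hc => ?_))
  rw [← Finsupp.sum_single c, Finsupp.smul_sum]
  refine Submodule.sum_mem _ fun γ _ => single_mem_of_forall γ (fun τ hτ f hf => ?_) (hc γ)
  obtain ⟨q, hq⟩ := Finset.dvd_prod_of_mem g (Finset.mem_univ (γ, τ))
  rw [hq, mul_assoc, mul_left_comm]
  have := (boundaries K r s ℓ o).smul_mem q (h (γ, τ) hτ f hf)
  rwa [smul_smul] at this

theorem idealOfVars_le_radical_colon (hK : K.faces.Finite)
    (hℓ : ∀ τ, IsLinearFormVanishingOn τ.1 (ℓ τ)) :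
    idealOfVars (Fin 3) ℝ ≤
      ((boundaries K r s ℓ o).colon (idealSum (vertexIdeal K r s ℓ))).radical := by
  rw [Ideal.radical_eq_sInf]
  refine le_sInf fun P hP => ?_
  by_contra h
  have := hP.2
  exact colon_not_le hK hℓ h hP.1

end Localization

/-! ### Finite length and powers of the irrelevant ideal -/

section FiniteLength

theorem idealOfVars_isMaximal {σ k : Type} [Field k] : (idealOfVars σ k).IsMaximal := by
  have hker : idealOfVars σ k = RingHom.ker (constantCoeff (R := k) (σ := σ)) := by
    ext p
    have := mem_pow_idealOfVars_iff' (σ := σ) (R := k) 1 p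
    rw [pow_one] at this
    rw [this, RingHom.mem_ker, constantCoeff_eq]
    simp [Finsupp.degree_eq_zero_iff]
  rw [hker]
  exact RingHom.ker_isMaximal_of_surjective _ fun c => ⟨C c, constantCoeff_C σ c⟩

/-- A finite module over `k[x₁, …, xₙ]` whose support is contained in the origin has finite
length. -/
theorem isFiniteLength_of_idealOfVars_le {σ k M : Type} [Finite σ] [Field k] [AddCommGroup M]
    [Module (MvPolynomial σ k) M] [Module.Finite (MvPolynomial σ k) M]
    (h : idealOfVars σ k ≤ (Module.annihilator (MvPolynomial σ k) M).radical) :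
    IsFiniteLength (MvPolynomial σ k) M := by
  set I := Module.annihilator (MvPolynomial σ k) M with hI
  -- Every minimal prime over `I` contains the maximal ideal of the origin, hence equals it.
  have hdim : Ring.KrullDimLE 0 (MvPolynomial σ k ⧸ I) := by
    rw [Ideal.krullDimLE_zero_quotient_iff_forall_minimalPrimes_isMaximal]
    intro P hP
    have hle : idealOfVars σ k ≤ P := h.trans (hP.1.1.radical_le_iff.2 hP.1.2)
    rw [← idealOfVars_isMaximal.eq_of_le hP.1.1.ne_top hle]
    exact idealOfVars_isMaximal
  have hart : IsArtinianRing (MvPolynomial σ k ⧸ I) :=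
    isArtinianRing_iff_isNoetherianRing_krullDimLE_zero.2 ⟨inferInstance, hdim⟩
  let _ : Module (MvPolynomial σ k ⧸ I) M := Module.quotientAnnihilator
  have htower : IsScalarTower (MvPolynomial σ k) (MvPolynomial σ k ⧸ I) M :=
    (Module.isTorsionBySet_annihilator _ M).isScalarTower
  have hfin : Module.Finite (MvPolynomial σ k ⧸ I) M :=
    Module.Finite.of_restrictScalars_finite (MvPolynomial σ k) _ _
  have hM : IsArtinian (MvPolynomial σ k ⧸ I) M := inferInstance
  rw [isFiniteLength_iff_isNoetherian_isArtinian]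
  exact ⟨inferInstance,
    isArtinian_of_surjective_algebraMap (R := MvPolynomial σ k ⧸ I) Ideal.Quotient.mk_surjective⟩

theorem mem_smul_top_of_forall {A ι : Type} [CommRing A] {I : Ideal A} {c : ι →₀ A}
    (h : ∀ i, c i ∈ I) : c ∈ I • (⊤ : Submodule A (ι →₀ A)) := by
  rw [← Finsupp.sum_single c]
  refine Submodule.sum_mem _ fun i _ => ?_
  have := Submodule.smul_mem_smul (h i) (Submodule.mem_top (x := Finsupp.single i (1 : A)))
  rwa [Finsupp.smul_single, smul_eq_mul, mul_one] at this

theorem mem_pow_idealOfVars_of_isHomogeneous {σ k : Type} [CommRing k] {p : MvPolynomial σ k} {d : ℕ}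
    (hp : p.IsHomogeneous d) : p ∈ idealOfVars σ k ^ d := by
  rw [mem_pow_idealOfVars_iff']
  exact fun x hx => hp.coeff_eq_zero hx.ne

end FiniteLength

/-! ### Annihilator of the zeroth homology -/

section ZerothHomology

variable {A M N : Type} [CommRing A] [AddCommGroup M] [Module A M] [AddCommGroup N] [Module A N]
    {f : M →ₗ[A] N} {P : Submodule A M} {Q : Submodule A N} {h : ∀ x ∈ P, f x ∈ Q}

theorem homologyClass_surjective : Function.Surjective (homologyClass f P Q h) :=
  Submodule.mkQ_surjective _

theorem homologyClass_eq_zero_iff {c : Q} : homologyClass f P Q h c = 0 ↔ c.1 ∈ P.map f := by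
  have h1 : homologyClass f P Q h c = 0 ↔ c ∈ LinearMap.range (f.restrict h) :=
    Submodule.Quotient.mk_eq_zero _
  rw [h1]
  constructor
  · rintro ⟨x, rfl⟩
    exact ⟨x.1, x.2, rfl⟩
  · rintro ⟨x, hx, hxc⟩
    exact ⟨⟨x, hx⟩, Subtype.ext hxc⟩

theorem colon_le_annihilator_zerothHomology :
    (P.map f).colon (Q : Set N) ≤ Module.annihilator A (zerothHomology f P Q h) := by
  intro a ha
  rw [Module.mem_annihilator]
  intro x
  obtain ⟨c, rfl⟩ := homologyClass_surjective x
  rw [← map_smul, homologyClass_eq_zero_iff]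
  exact Submodule.mem_colon.1 ha _ c.2

end ZerothHomology

end Superspline

end

theorem lemma5p1 (K : Superspline.PlanarComplex) (hK : K.faces.Finite)
    (r : Superspline.InteriorEdge K → ℕ) (s : K.vertices → ℕ)
    (ℓ : Superspline.InteriorEdge K → Superspline.S)
    (hℓ : ∀ τ, Superspline.IsLinearFormVanishingOn τ.1 (ℓ τ))
    (o : Superspline.EdgeOrientation K) :
    IsFiniteLength Superspline.S (Superspline.H0 K r s ℓ o) ∧
      ∃ D : ℕ, ∀ d : ℕ, D ≤ d → Superspline.H0Degree K r s ℓ o d = ⊥ := by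
  open Superspline MvPolynomial in
  have := finite_interiorVertex hK
  have hrad := idealOfVars_le_radical_colon (r := r) (s := s) (o := o) hK hℓ
  constructor
  · have : Module.Finite S (H0 K r s ℓ o) :=
      Module.Finite.of_surjective _ homologyClass_surjective
    exact isFiniteLength_of_idealOfVars_le
      (hrad.trans (Ideal.radical_mono colon_le_annihilator_zerothHomology))
  · obtain ⟨n, hn⟩ := Ideal.exists_pow_le_of_le_radical_of_fg hrad (IsNoetherian.noetherian _)
    -- Degree $d$ only places `c` in $\mathfrak m^d$ times the free module. Artin–Rees moves it into
    -- $\mathfrak m^{d-k}$ times $\bigoplus J(\gamma)$, and $d-k\ge n$ makes it a boundary.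
    obtain ⟨k, hk⟩ := Ideal.exists_pow_inf_eq_pow_smul (idealOfVars (Fin 3) ℝ)
      (idealSum (vertexIdeal K r s ℓ))
    refine ⟨k + n, fun d hd => ?_⟩
    rw [eq_bot_iff]
    rintro _ ⟨c, hc, rfl⟩
    rw [AddSubgroup.mem_bot, homologyClass_eq_zero_iff]
    have hmem : c.1 ∈ idealOfVars (Fin 3) ℝ ^ d • ⊤ ⊓ idealSum (vertexIdeal K r s ℓ) :=
      ⟨mem_smul_top_of_forall fun γ => mem_pow_idealOfVars_of_isHomogeneous (hc γ), c.2⟩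
    rw [hk d (by omega)] at hmem
    refine Submodule.smul_le.2 (fun a ha x hx => ?_) hmem
    exact Submodule.mem_colon.1 (hn (Ideal.pow_le_pow_right (by omega) ha)) x hx.2
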